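/- Let $n\ge 1$ and $1\le r\le n$. For a complex $n\times n$ matrix $A$ let $g_r(A)$ be the sum of the $r\times r$ principal minors of $A$, so that the characteristic polynomial of $A$ is $x^n-g_1(A)x^{n-1}+g_2(A)x^{n-2}-\cdots+(-1)^n g_n(A)$, and let $\|A\|$ be the operator norm of $A$, i.e. its largest singular value. Then for all complex $n\times n$ matrices $A$ and $X$, $$|g_r(A+X)-g_r(A)|\le\sum_{k=1}^{r}\binom{n}{r}\binom{r}{k}\|A\|^{r-k}\|X\|^k .$$ -/

import Mathlib

open scoped Matrix.Norms.L2Operator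

/-- `charCoeff r A` is `g_r(A)`, the sum of the `r × r` principal minors `det A[I|I]` of the
complex `n × n` matrix `A`, where `I` runs over the `r`-element subsets of the index set. -/
noncomputable def charCoeff {n : ℕ} (r : ℕ) (A : Matrix (Fin n) (Fin n) ℂ) : ℂ :=
  ∑ I ∈ (Finset.univ : Finset (Fin n)).powersetCard r,
    (A.submatrix (fun i : I => (i : Fin n)) (fun i : I => (i : Fin n))).det

/-- The characteristic polynomial of `A` is `x^n - g_1 x^(n-1) + g_2 x^(n-2) - ... + (-1)^n g_n`. -/
theorem charpoly_coeff_eq_charCoeff {n : ℕ} (r : ℕ) (hr : r ≤ n)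
    (A : Matrix (Fin n) (Fin n) ℂ) :
    A.charpoly.coeff (n - r) = (-1) ^ r * charCoeff r A := by
  have h := Matrix.charpoly_coeff_eq_sum_minors A r (by simpa using hr)
  rw [Fintype.card_fin] at h
  exact h

/-! Each principal minor is treated separately. Multilinearity in the rows expands `det (A + X)`
over the sets `s` of rows taken from `X`. The set `s = ∅` gives `det A`; Hadamard's inequality
bounds each other term by `‖A‖ ^ (r - |s|) * ‖X‖ ^ |s|`, as rows of a submatrix have norm at most
the operator norm. There are `r.choose k` sets of size `k` and `n.choose r` minors. -/

/-- **Hadamard's inequality** for a linearly ordered index type. -/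
theorem norm_det_le_prod_norm_row {ι : Type*} [Fintype ι] [LinearOrder ι]
    (M : Matrix ι ι ℂ) : ‖M.det‖ ≤ ∏ i, ‖WithLp.toLp 2 (M i)‖ := by
  let : LocallyFiniteOrder ι := Fintype.toLocallyFiniteOrder
  let : LocallyFiniteOrderBot ι :=
    LocallyFiniteOrderBot.ofIic ι (fun a => Finset.univ.filter (· ≤ a)) (by simp)
  let f : ι → EuclideanSpace ℂ ι := fun i => WithLp.toLp 2 (M i)
  let e := EuclideanSpace.basisFun ι ℂ
  have hcard : Module.finrank ℂ (EuclideanSpace ℂ ι) = Fintype.card ι := finrank_euclideanSpace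
  let b := InnerProductSpace.gramSchmidtOrthonormalBasis hcard f
  have hM : M.det = e.toBasis.det f := by
    rw [Module.Basis.det_apply, ← Matrix.det_transpose]
    congr 1
  have hchange : e.toBasis.det f = e.toBasis.det b * b.toBasis.det f := by
    simp only [Module.Basis.det_apply]
    rw [← Matrix.det_mul, ← b.coe_toBasis, Module.Basis.toMatrix_mul_toMatrix]
  -- A change between orthonormal bases has determinant of modulus 1; in the Gram–Schmidt basis `f`
  -- is triangular, with diagonal entries `⟪b i, f i⟫`.
  rw [hM, hchange, norm_mul, OrthonormalBasis.det_to_matrix_orthonormalBasis, one_mul,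
    InnerProductSpace.gramSchmidtOrthonormalBasis_det, norm_prod]
  refine Finset.prod_le_prod (fun _ _ => norm_nonneg _) fun i _ => ?_
  refine (norm_inner_le_norm _ _).trans ?_
  rw [OrthonormalBasis.norm_eq_one, one_mul]

/-- Perturbation bound for the determinant in terms of bounds for the norms of the rows. -/
theorem norm_det_add_sub_det_le {ι : Type*} [Fintype ι] [LinearOrder ι]
    (A X : Matrix ι ι ℂ) {a x : ℝ}
    (hA : ∀ i, ‖WithLp.toLp 2 (A i)‖ ≤ a) (hX : ∀ i, ‖WithLp.toLp 2 (X i)‖ ≤ x) :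
    ‖(A + X).det - A.det‖ ≤ ∑ k ∈ Finset.Icc 1 (Fintype.card ι),
      ((Fintype.card ι).choose k : ℝ) * a ^ (Fintype.card ι - k) * x ^ k := by
  have hterm (s : Finset ι) : ‖(Matrix.of (s.piecewise X.row A.row)).det‖ ≤
      a ^ (Fintype.card ι - s.card) * x ^ s.card := by
    refine (norm_det_le_prod_norm_row _).trans ?_
    calc _ ≤ ∏ i, s.piecewise (fun _ => x) (fun _ => a) i := by
          refine Finset.prod_le_prod (fun _ _ => norm_nonneg _) fun i _ => ?_
          change ‖WithLp.toLp 2 (s.piecewise X.row A.row i)‖ ≤ _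
          by_cases h : i ∈ s
          · rw [Finset.piecewise_eq_of_mem _ _ _ h, Finset.piecewise_eq_of_mem _ _ _ h]
            exact hX i
          · rw [Finset.piecewise_eq_of_notMem _ _ _ h, Finset.piecewise_eq_of_notMem _ _ _ h]
            exact hA i
      _ = _ := by
          rw [Finset.prod_piecewise]
          simp [Finset.card_univ_sdiff, mul_comm]
  have hexp : (A + X).det = ∑ s : Finset ι, (Matrix.of (s.piecewise X.row A.row)).det := by
    rw [add_comm]
    exact (Matrix.detRowAlternating (R := ℂ) (n := ι)).toMultilinearMap.map_add_univ X.row A.row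
  have hsub : (A + X).det - A.det = ∑ s ∈ (Finset.univ : Finset (Finset ι)).erase ∅,
      (Matrix.of (s.piecewise X.row A.row)).det := by
    rw [hexp, ← Finset.add_sum_erase _ _ (Finset.mem_univ ∅), Finset.piecewise_empty]
    exact add_sub_cancel_left _ _
  -- Vanishing at 0 lets `∅` rejoin the sum, which is then grouped by cardinality.
  let g : ℕ → ℝ := fun k => if k = 0 then 0 else a ^ (Fintype.card ι - k) * x ^ k
  calc ‖(A + X).det - A.det‖
      ≤ ∑ s ∈ (Finset.univ : Finset (Finset ι)).erase ∅, g s.card := by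
        rw [hsub]
        refine norm_sum_le_of_le _ fun s hs => ?_
        have hs' : s ≠ ∅ := Finset.ne_of_mem_erase hs
        simpa [g, hs'] using hterm s
    _ = ∑ s ∈ (Finset.univ : Finset ι).powerset, g s.card := by
        rw [Finset.powerset_univ]
        exact Finset.sum_erase _ (by simp [g])
    _ = _ := by
        rw [Finset.sum_powerset_apply_card, Finset.card_univ, Finset.range_eq_Ico,
          Finset.sum_eq_sum_Ico_succ_bot (Nat.succ_pos _)]
        simp only [g, if_true, smul_zero, zero_add]
        refine Finset.sum_congr (by ext; simp) fun k hk => ?_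
        have hk : k ≠ 0 := by simp at hk; omega
        simp [hk, mul_assoc]

theorem norm_toLp_row_le {n : ℕ} (A : Matrix (Fin n) (Fin n) ℂ) (i : Fin n) :
    ‖WithLp.toLp 2 (A i)‖ ≤ ‖A‖ := by
  -- Row `i` of `A` is, up to conjugation, the image of a unit vector under the adjoint.
  have h := Matrix.l2_opNorm_mulVec A.conjTranspose (EuclideanSpace.single i 1)
  rw [Matrix.l2_opNorm_conjTranspose] at h
  simpa [EuclideanSpace.norm_eq, Matrix.mulVec_single_one, Matrix.col] using h

theorem norm_toLp_submatrix_row_le {n : ℕ} (A : Matrix (Fin n) (Fin n) ℂ)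
    (I : Finset (Fin n)) (i : I) :
    ‖WithLp.toLp 2 (A.submatrix (fun i : I => (i : Fin n)) (fun i : I => (i : Fin n)) i)‖ ≤
      ‖A‖ := by
  refine le_trans ?_ (norm_toLp_row_le A i)
  rw [EuclideanSpace.norm_eq, EuclideanSpace.norm_eq]
  refine Real.sqrt_le_sqrt ?_
  simp only [Matrix.submatrix_apply]
  rw [Finset.sum_coe_sort I (fun j => ‖A i j‖ ^ 2)]
  exact Finset.sum_le_sum_of_subset_of_nonneg (Finset.subset_univ _) fun _ _ _ => by positivity

/-- Here `‖·‖` is the operator norm induced by the Euclidean norm (the largest singular value). -/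
theorem corollary3p2 (n r : ℕ) (hr : 1 ≤ r) (hrn : r ≤ n) (A X : Matrix (Fin n) (Fin n) ℂ) :
    ‖charCoeff r (A + X) - charCoeff r A‖ ≤
      ∑ k ∈ Finset.Icc 1 r,
        ((n.choose r : ℝ) * (r.choose k : ℝ)) * ‖A‖ ^ (r - k) * ‖X‖ ^ k := by
  rw [charCoeff, charCoeff, ← Finset.sum_sub_distrib]
  calc _ ≤ ∑ I ∈ (Finset.univ : Finset (Fin n)).powersetCard r,
        ∑ k ∈ Finset.Icc 1 r, (r.choose k : ℝ) * ‖A‖ ^ (r - k) * ‖X‖ ^ k := by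
        refine norm_sum_le_of_le _ fun I hI => ?_
        have hcard : Fintype.card I = r := by
          rw [Fintype.card_coe, (Finset.mem_powersetCard.mp hI).2]
        have h := norm_det_add_sub_det_le _ _ (norm_toLp_submatrix_row_le A I)
          (norm_toLp_submatrix_row_le X I)
        rw [hcard] at h
        exact h
    _ = _ := by
        rw [Finset.sum_const, Finset.card_powersetCard, Finset.card_univ, Fintype.card_fin,
          nsmul_eq_mul, Finset.mul_sum]
        exact Finset.sum_congr rfl fun k _ => by ring
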